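/- Let $f$ be a nonconstant meromorphic function in the complex plane, with Nevanlinna characteristic $T(r,f)=m(r,f)+N(r,f)$, where $m(r,g)=\frac{1}{2\pi}\int_0^{2\pi}\log^+|g(re^{i\theta})|\,d\theta$ is the proximity function and $N(r,f)$ is the integrated counting function of the poles of $f$, counted with multiplicity. Suppose that $f$ has finite logarithmic order $$\sigma_{\log}(f)=\limsup_{r\to\infty}\frac{\log^+T(r,f)}{\log\log r}<\infty .$$ Let $k\in\mathbb{N}$ and $q\in\mathbb{C}\setminus\{0\}$. Then for every $\varepsilon>0$, $$m\left(r,\frac{f(q^kz)}{f(z)}\right)=O\left((\log r)^{\sigma_{\log}(f)-1+\varepsilon}\right)\qquad(r\to\infty),$$ and, if moreover $q\neq1$, $$m\left(r,\frac{D_q^kf(z)}{f(z)}\right)=O\left((\log r)^{\sigma_{\log}(f)-1+\varepsilon}\right)\qquad(r\to\infty),$$ where $D_q$ is the Jackson difference operator $D_qg(z)=\frac{g(qz)-g(z)}{qz-z}$, and $D_q^0g=g$, $D_q^{k}g=D_q(D_q^{k-1}g)$. The estimates hold as $r\to\infty$ without an exceptional set. -/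

import Mathlib

open Filter Asymptotics

noncomputable section

/-- The Jackson difference operator `D_q f (z) = (f (q z) - f z) / (q z - z)`, for `q ≠ 1`. The
formula determines a meromorphic function by its values at `z ≠ 0`; the value given to the
quotient at the single point `z = 0` is immaterial, since for `q ≠ 0` no value of an iterate at a
point `z ≠ 0` depends on it. -/
def jacksonD (q : ℂ) (f : ℂ → ℂ) : ℂ → ℂ :=
  fun z => (f (q * z) - f z) / (q * z - z)

/-- The iterated Jackson operator: `D_q^0 f = f` and `D_q^(k+1) f = D_q (D_q^k f)`. -/
def jacksonDIter (q : ℂ) : ℕ → (ℂ → ℂ) → (ℂ → ℂ)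
  | 0, f => f
  | k + 1, f => jacksonD q (jacksonDIter q k f)

/-- The logarithmic order `limsup_{r → ∞} log⁺ T(r, f) / log (log r)`, as an extended real number,
where `T(r, f) = m(r, f) + N(r, f)` is the Nevanlinna characteristic function. -/
def logOrder (f : ℂ → ℂ) : EReal :=
  limsup (fun r : ℝ =>
    ((Real.posLog (ValueDistribution.characteristic f ⊤ r) / Real.log (Real.log r) : ℝ) : EReal))
    atTop

end

/-! On the disk of radius R = r², write f as a zero-free g times linear factors (z - a)^d(a). Then
log|f(qz)/f(z)| splits into two parts. Each linear factor contributes O(1) in the mean on |z| = r,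
uniformly in a and r (`circleAverage_abs_log_norm_mul_sub_sub_le`). The number n of zeros and poles
satisfies n log R ≤ N(R², f) + N(R², 1/f), which is where a power of log r is gained
(`sum_mul_log_le_logCounting`). For g, the Poisson formula gives a factor O(r/R) = O(1/r), which
outweighs every power of log r (`abs_log_norm_sub_log_norm_le`). Passing from r to r² or r⁴ only
multiplies (log r)^s by a constant, and each bound holds for all large r, so no exceptional set
appears. The number q^k is just another nonzero dilation factor, and D_q^k f is dominated by the
f(q^j z), j ≤ k. -/

/-! ### Poisson kernel and Harnack estimate -/

open Real Metric Complex in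
/-- Two values of the Poisson kernel of the disk of radius `R` differ little if their poles are
close to the centre. -/
lemma abs_re_herglotzRieszKernel_sub_le {R ρ : ℝ} {w w' ζ : ℂ} (hR : 0 < R) (hρ : 2 * ρ ≤ R)
    (hw : ‖w‖ ≤ ρ) (hw' : ‖w'‖ ≤ ρ) (hζ : ζ ∈ sphere 0 R) :
    |(herglotzRieszKernel 0 w ζ).re - (herglotzRieszKernel 0 w' ζ).re| ≤ 6 * ρ / R := by
  -- The kernel lies between (R - ‖v‖)/(R + ‖v‖) and (R + ‖v‖)/(R - ‖v‖); the upper bound uses R - ρ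
  -- ≥ R/2.
  have key : ∀ v : ℂ, ‖v‖ ≤ ρ → 1 - 2 * ρ / R ≤ (herglotzRieszKernel 0 v ζ).re ∧
      (herglotzRieszKernel 0 v ζ).re ≤ 1 + 4 * ρ / R := by
    intro v hv
    have h0 := norm_nonneg v
    have hvb : v ∈ ball (0 : ℂ) R := by
      rw [mem_ball_zero_iff]; linarith
    have h1 := re_herglotzRieszKernel_le hζ hvb
    have h2 := le_re_herglotzRieszKernel hζ hvb
    rw [sub_zero v] at h1 h2
    rw [herglotzRieszKernel_def, sub_zero v]
    constructor
    · refine le_trans ?_ h2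
      rw [sub_le_iff_le_add, div_add_div _ _ (by positivity) hR.ne', le_div_iff₀ (by positivity)]
      nlinarith
    · refine le_trans h1 ?_
      rw [← sub_le_iff_le_add', le_div_iff₀ hR, sub_mul, one_mul, div_mul_eq_mul_div,
        sub_le_iff_le_add, div_le_iff₀ (by linarith)]
      nlinarith
  obtain ⟨h1, h2⟩ := key w hw
  obtain ⟨h3, h4⟩ := key w' hw'
  have : 6 * ρ / R = 2 * ρ / R + 4 * ρ / R := by ring
  rw [abs_le]
  constructor <;> linarith

open Real Metric Complex in
/-- A Harnack type inequality for the logarithm of the modulus of a zero-free function. -/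
lemma abs_log_norm_sub_log_norm_le {g : ℂ → ℂ} {R ρ : ℝ} {w w' : ℂ}
    (hg : AnalyticOnNhd ℂ g (closedBall 0 R)) (hg0 : ∀ u ∈ closedBall (0 : ℂ) R, g u ≠ 0)
    (hR : 0 < R) (hρ : 2 * ρ ≤ R) (hw : ‖w‖ ≤ ρ) (hw' : ‖w'‖ ≤ ρ) :
    |Real.log ‖g w‖ - Real.log ‖g w'‖| ≤ 6 * ρ / R * circleAverage (fun z => |Real.log ‖g z‖|) 0 R := by
  have hharm : InnerProductSpace.HarmonicOnNhd (fun z => Real.log ‖g z‖) (closedBall 0 R) :=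
    fun x hx => (hg x hx).harmonicAt_log_norm (hg0 x hx)
  have hb : ∀ v : ℂ, ‖v‖ ≤ ρ → v ∈ ball (0 : ℂ) R := by
    intro v hv
    have := norm_nonneg v
    rw [mem_ball_zero_iff]; linarith
  have hint : CircleIntegrable (fun z => Real.log ‖g z‖) 0 R := by
    apply MeromorphicOn.circleIntegrable_log_norm
    rw [abs_of_pos hR]
    exact (hg.mono sphere_subset_closedBall).meromorphicOn
  have hk : ∀ v : ℂ, ‖v‖ ≤ ρ →
      CircleIntegrable ((re ∘ herglotzRieszKernel 0 v) • fun z => Real.log ‖g z‖) 0 R := fun v hv =>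
    hint.continuousOn_smul
      (continuous_re.comp_continuousOn (continuousOn_herglotzRieszKernel_sphere (hb v hv)))
  rw [← hharm.circleAverage_re_herglotzRieszKernel_smul (hb w hw),
    ← hharm.circleAverage_re_herglotzRieszKernel_smul (hb w' hw'),
    ← circleAverage_sub (hk w hw) (hk w' hw'), ← smul_eq_mul (6 * ρ / R),
    ← circleAverage_fun_smul]
  refine abs_circleAverage_le_circleAverage_abs.trans
    (circleAverage_mono ((hk w hw).sub (hk w' hw')).abs hint.abs.const_smul ?_)
  intro z hz
  rw [abs_of_pos hR] at hz
  have := abs_re_herglotzRieszKernel_sub_le hR hρ hw hw' hz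
  change |(herglotzRieszKernel 0 w z).re * Real.log ‖g z‖ -
    (herglotzRieszKernel 0 w' z).re * Real.log ‖g z‖| ≤ 6 * ρ / R * |Real.log ‖g z‖|
  rw [← sub_mul, abs_mul]
  gcongr

/-! ### Means of logarithms of linear factors -/

-- The difference has constant sign on the circle, so Jensen's formula evaluates the mean as log(r +
-- ‖b‖) - log max(r, ‖b‖). Centring at log(r + ‖b‖) is what makes the bound uniform.
open Real Metric in
lemma circleAverage_abs_log_norm_sub_sub_log_le {r : ℝ} (hr : 1 ≤ r) (b : ℂ) :
    circleAverage (fun z => |log ‖z - b‖ - log (r + ‖b‖)|) 0 r ≤ log 2 := by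
  have hr0 : 0 < r := by linarith
  have hb := norm_nonneg b
  have hint : CircleIntegrable (fun z => log ‖z - b‖) 0 r := circleIntegrable_log_norm_sub_const r
  have h1 : circleAverage (fun z => |log ‖z - b‖ - log (r + ‖b‖)|) 0 r
      = circleAverage (fun z => log (r + ‖b‖) - log ‖z - b‖) 0 r := by
    apply circleAverage_congr_sphere
    intro z hz
    rw [abs_of_pos hr0, mem_sphere_zero_iff_norm] at hz
    have : log ‖z - b‖ ≤ log (r + ‖b‖) := by
      rcases (norm_nonneg (z - b)).eq_or_lt with h | h
      · rw [← h, log_zero]; exact log_nonneg (by linarith)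
      · exact log_le_log h (hz ▸ norm_sub_le z b)
    simp only
    rw [abs_of_nonpos (by linarith), neg_sub]
  rw [h1, circleAverage_fun_sub (circleIntegrable_const _ _ _) hint, circleAverage_const,
    circleAverage_log_norm_sub_const_eq_log_radius_add_posLog hr0.ne', zero_sub, norm_neg,
    posLog_eq_log_max_one (by positivity), ← log_mul hr0.ne' (by positivity), sub_le_iff_le_add,
    ← log_mul (by norm_num) (by positivity)]
  apply log_le_log (by positivity)
  rw [mul_max_of_nonneg _ _ hr0.le, mul_inv_cancel_left₀ hr0.ne', mul_one]
  linarith [le_max_left r ‖b‖, le_max_right r ‖b‖]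

-- The growth in R is harmless: this only serves to bound the zero-free factor, whose contribution
-- is later multiplied by ρ/R.
open Real Metric in
lemma circleAverage_abs_log_norm_sub_le {R : ℝ} (hR : 1 ≤ R) {a : ℂ} (ha : ‖a‖ ≤ R) :
    circleAverage (fun z => |log ‖z - a‖|) 0 R ≤ log (4 * R) := by
  have hint : CircleIntegrable (fun z => log ‖z - a‖) 0 R := circleIntegrable_log_norm_sub_const R
  have hi2 : CircleIntegrable (fun z => |log ‖z - a‖ - log (R + ‖a‖)|) 0 R :=
    (hint.sub (circleIntegrable_const (log (R + ‖a‖)) 0 R)).abs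
  have ha0 := norm_nonneg a
  calc circleAverage (fun z => |log ‖z - a‖|) 0 R
      ≤ circleAverage (fun z => |log ‖z - a‖ - log (R + ‖a‖)| + log (R + ‖a‖)) 0 R := by
        refine circleAverage_mono hint.abs (hi2.add (circleIntegrable_const _ _ _)) fun z _ => ?_
        have h0 : 0 ≤ log (R + ‖a‖) := log_nonneg (by linarith)
        have := abs_add_le (log ‖z - a‖ - log (R + ‖a‖)) (log (R + ‖a‖))
        rwa [sub_add_cancel, abs_of_nonneg h0] at this
    _ = circleAverage (fun z => |log ‖z - a‖ - log (R + ‖a‖)|) 0 R + log (R + ‖a‖) := by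
        rw [circleAverage_fun_add hi2 (circleIntegrable_const _ _ _), circleAverage_const]
    _ ≤ log 2 + log (R + ‖a‖) := by
        gcongr; exact circleAverage_abs_log_norm_sub_sub_log_le hR a
    _ ≤ log (4 * R) := by
        rw [← log_mul (by norm_num) (by positivity)]
        exact log_le_log (by positivity) (by linarith)

open Real Metric in
/-- The logarithmic `q`-difference of a linear factor is bounded in the mean, uniformly in the
radius and in the zero of the factor. -/
lemma circleAverage_abs_log_norm_mul_sub_sub_le {q : ℂ} (hq : q ≠ 0) {r : ℝ} (hr : 1 ≤ r) (a : ℂ) :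
    circleAverage (fun z => |log ‖q * z - a‖ - log ‖z - a‖|) 0 r
      ≤ 2 * log 2 + 2 * |log ‖q‖| := by
  have hr0 : 0 < r := by linarith
  have hq0 : 0 < ‖q‖ := norm_pos_iff.2 hq
  -- Now qz - a = q(z - b), so both logarithms can be centred, at log(r + ‖b‖) and log(r + ‖qb‖),
  -- which differ by at most |log ‖q‖|.
  obtain ⟨b, rfl⟩ : ∃ b, a = q * b := ⟨a / q, by field_simp⟩
  have hb := norm_nonneg b
  have hi : ∀ c : ℂ, CircleIntegrable (fun z => |log ‖z - c‖ - log (r + ‖c‖)|) 0 r := fun c =>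
    ((circleIntegrable_log_norm_sub_const r).sub (circleIntegrable_const (log (r + ‖c‖)) 0 r)).abs
  have hi1 : CircleIntegrable (fun z => log ‖q * z - q * b‖) 0 r :=
    MeromorphicOn.circleIntegrable_log_norm (fun z _ => by fun_prop)
  have hi2 : CircleIntegrable (fun z => |log ‖z - b‖ - log (r + ‖b‖)| +
      |log ‖z - q * b‖ - log (r + ‖q * b‖)|) 0 r := (hi b).add (hi _)
  have hlog : |log (r + ‖b‖) - log (r + ‖q * b‖)| ≤ |log ‖q‖| := by
    rw [norm_mul, ← log_div (by positivity) (by positivity)]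
    rcases le_total ‖q‖ 1 with h | h
    · rw [abs_of_nonpos (log_nonpos hq0.le h), abs_of_nonneg, ← log_inv]
      · apply log_le_log (by positivity)
        rw [div_le_iff₀ (by positivity)]
        field_simp
        nlinarith
      · apply log_nonneg
        rw [le_div_iff₀ (by positivity)]
        nlinarith
    · rw [abs_of_nonneg (log_nonneg h), abs_of_nonpos, ← log_inv]
      · apply log_le_log (by positivity)
        rw [inv_div, div_le_iff₀ (by positivity)]
        nlinarith
      · apply log_nonpos (by positivity)
        rw [div_le_iff₀ (by positivity)]
        nlinarith
  calc circleAverage (fun z => |log ‖q * z - q * b‖ - log ‖z - q * b‖|) 0 r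
      ≤ circleAverage (fun z => (|log ‖z - b‖ - log (r + ‖b‖)| +
          |log ‖z - q * b‖ - log (r + ‖q * b‖)|) + 2 * |log ‖q‖|) 0 r := by
        refine circleAverage_mono (hi1.sub (circleIntegrable_log_norm_sub_const r)).abs
          (hi2.add (circleIntegrable_const _ _ _)) fun z _ => ?_
        have h1 : |log ‖q * z - q * b‖ - log ‖z - b‖| ≤ |log ‖q‖| := by
          rw [← mul_sub, norm_mul]
          rcases eq_or_ne ‖z - b‖ 0 with h | h
          · simp [h]
          · rw [log_mul hq0.ne' h, add_sub_cancel_right]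
        grind
    _ = circleAverage (fun z => |log ‖z - b‖ - log (r + ‖b‖)|) 0 r +
          circleAverage (fun z => |log ‖z - q * b‖ - log (r + ‖q * b‖)|) 0 r + 2 * |log ‖q‖| := by
        rw [circleAverage_fun_add hi2 (circleIntegrable_const _ _ _),
          circleAverage_const, circleAverage_fun_add (hi b) (hi _)]
    _ ≤ 2 * log 2 + 2 * |log ‖q‖| := by
        linarith [circleAverage_abs_log_norm_sub_sub_log_le hr b,
          circleAverage_abs_log_norm_sub_sub_log_le hr (q * b)]

/-! ### Counting zeros and poles -/

open Real in
/-- The number of points of a divisor in the disk of radius `R` is controlled by its logarithmic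
counting function at `R ^ 2`. -/
lemma sum_mul_log_le_logCounting {D : Function.locallyFinsupp ℂ ℤ} (hD : 0 ≤ D) {R : ℝ}
    (hR : 1 ≤ R) (s : Finset ℂ) (hs : ∀ a ∈ s, ‖a‖ ≤ R) :
    (∑ a ∈ s, (D a : ℝ)) * log R ≤ Function.locallyFinsuppWithin.logCounting D (R ^ 2) := by
  classical
  have hR2 : R ≤ R ^ 2 := by nlinarith
  have hle : ∑ a ∈ s, Function.locallyFinsuppWithin.single a (D a) ≤ D := by
    intro z
    rw [Function.locallyFinsuppWithin.coe_sum, Finset.sum_apply]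
    simp only [Function.locallyFinsuppWithin.single_apply]
    rw [Finset.sum_ite_eq]
    split_ifs
    · exact le_rfl
    · exact hD z
  refine le_trans ?_ (Function.locallyFinsuppWithin.logCounting_le hle (hR.trans hR2))
  rw [map_sum, Finset.sum_apply, Finset.sum_mul]
  refine Finset.sum_le_sum fun a ha => ?_
  -- At radius R² the point a has weight log R² - log ‖a‖ ≥ log R; with `log 0 = 0` this includes a
  -- = 0.
  rw [Function.locallyFinsuppWithin.logCounting_single_eq_log_sub_const ((hs a ha).trans hR2)]
  have hDa : (0 : ℝ) ≤ D a := by exact_mod_cast hD a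
  gcongr
  have : log ‖a‖ ≤ log R := by
    rcases (norm_nonneg a).eq_or_lt with h | h
    · rw [← h, log_zero]; exact log_nonneg hR
    · exact log_le_log h (hs a ha)
  rw [log_pow]
  push_cast
  linarith

/-! ### Factorization on a disk -/

open Real Metric ValueDistribution in
/-- The circle average of `|log ‖f ·‖|` is the sum of two proximity functions. -/
lemma circleAverage_abs_log_norm_eq {f : ℂ → ℂ} (hf : Meromorphic f) (r : ℝ) :
    circleAverage (fun z => |log ‖f z‖|) 0 r = proximity f ⊤ r + proximity f⁻¹ ⊤ r := by
  rw [proximity_top, proximity_top, ← circleAverage_fun_add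
    hf.meromorphicOn.circleIntegrable_posLog_norm hf.inv.meromorphicOn.circleIntegrable_posLog_norm]
  congr 1
  ext z
  simp only [Pi.inv_apply, norm_inv, posLog_apply, log_inv]
  rcases le_total 0 (log ‖f z‖) with h | h
  · rw [abs_of_nonneg h, max_eq_right h, max_eq_left (by linarith), add_zero]
  · rw [abs_of_nonpos h, max_eq_left h, max_eq_right (by linarith), zero_add]

open Real Metric in
/-- Factorization of a meromorphic function on a disk, in logarithmic form. -/
lemma exists_log_norm_eq_sum_add {f : ℂ → ℂ} (hf : Meromorphic f)
    (hf0 : ∀ z, meromorphicOrderAt f z ≠ ⊤) (R : ℝ) :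
    ∃ (s : Finset ℂ) (g : ℂ → ℂ), (∀ a ∈ s, ‖a‖ ≤ R) ∧ AnalyticOnNhd ℂ g (closedBall 0 R) ∧
      (∀ u ∈ closedBall (0 : ℂ) R, g u ≠ 0) ∧
      (∀ᶠ z in codiscreteWithin (closedBall (0 : ℂ) R), log ‖f z‖ =
        ∑ a ∈ s, (MeromorphicOn.divisor f Set.univ a : ℝ) * log ‖z - a‖ + log ‖g z‖) := by
  classical
  have hfU : MeromorphicOn f (closedBall 0 R) := hf.meromorphicOn
  set D := MeromorphicOn.divisor f (closedBall 0 R) with hD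
  have hfin := D.finiteSupport (isCompact_closedBall 0 R)
  obtain ⟨g, hg, hg0, hfg⟩ := hfU.extract_zeros_poles (fun u => hf0 u) hfin
  have hsub : ∀ a ∈ hfin.toFinset, a ∈ closedBall (0 : ℂ) R := fun a ha =>
    D.supportWithinDomain (hfin.mem_toFinset.1 ha)
  refine ⟨hfin.toFinset, g, fun a ha => mem_closedBall_zero_iff.1 (hsub a ha), hg,
    fun u hu => hg0 ⟨u, hu⟩, ?_⟩
  filter_upwards [MeromorphicOn.extract_zeros_poles_log hg0 hfg] with z hz
  rw [hz, finsum_eq_sum_of_support_subset (s := hfin.toFinset), Pi.add_apply, Finset.sum_apply]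
  · congr 1
    refine Finset.sum_congr rfl fun a ha => ?_
    have : D a = MeromorphicOn.divisor f Set.univ a := by
      rw [hD, MeromorphicOn.divisor_apply hfU (hsub a ha),
        MeromorphicOn.divisor_apply hf.meromorphicOn (Set.mem_univ a)]
    simp [← this, hD]
  · intro a ha
    simp only [Function.mem_support, ne_eq] at ha
    rw [hfin.coe_toFinset, Function.mem_support]
    intro h
    apply ha
    rw [← hD, h]
    ext
    simp

open Metric in
/-- A property that holds off a discrete subset of a disk holds off a discrete subset of each
circle that a dilation maps into the disk. -/
lemma eventually_codiscreteWithin_sphere_mul {p : ℂ → Prop} {q : ℂ} (hq : q ≠ 0) {r R : ℝ}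
    (hqr : ‖q‖ * r ≤ R) (hp : ∀ᶠ z in codiscreteWithin (closedBall (0 : ℂ) R), p z) :
    ∀ᶠ z in codiscreteWithin (sphere (0 : ℂ) r), p (q * z) := by
  refine AnalyticOnNhd.preimage_mem_codiscreteWithin (f := fun z => q * z) (s := {z | p z})
    (fun z _ => by fun_prop) (fun x _ hx => ?_) (codiscreteWithin_mono ?_ hp)
  · rw [eventuallyConst_iff_exists_eventuallyEq] at hx
    obtain ⟨c, hc⟩ := hx
    have h1 : HasDerivAt (fun z => q * z) q x := by simpa using (hasDerivAt_id x).const_mul q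
    have h2 : HasDerivAt (fun z => q * z) 0 x := (hasDerivAt_const x c).congr_of_eventuallyEq hc
    exact hq (h1.unique h2)
  · rintro _ ⟨z, hz, rfl⟩
    rw [mem_sphere_zero_iff_norm] at hz
    rw [mem_closedBall_zero_iff, norm_mul, hz]
    exact hqr

lemma Meromorphic.comp_const_mul {f : ℂ → ℂ} (hf : Meromorphic f) (q : ℂ) :
    Meromorphic (fun z => f (q * z)) := fun z =>
  (hf (q * z)).comp_analyticAt (g := fun z => q * z) (by fun_prop)

open Real Metric ValueDistribution in
/-- Mean of `|log ‖g‖|` on a circle, for the zero-free factor `g` of a meromorphic function. -/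
lemma circleAverage_abs_log_norm_analytic_le {f g : ℂ → ℂ} (hf : Meromorphic f) {R : ℝ}
    (hR : 1 ≤ R) (s : Finset ℂ) (d : ℂ → ℝ) (hs : ∀ a ∈ s, ‖a‖ ≤ R)
    (hfg : ∀ᶠ z in codiscreteWithin (closedBall (0 : ℂ) R), log ‖f z‖ =
        ∑ a ∈ s, d a * log ‖z - a‖ + log ‖g z‖) :
    circleAverage (fun z => |log ‖g z‖|) 0 R ≤
      proximity f ⊤ R + proximity f⁻¹ ⊤ R + (∑ a ∈ s, |d a|) * log (4 * R) := by
  have hR0 : 0 < R := by linarith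
  have hi1 : CircleIntegrable (fun z => log ‖f z‖) 0 R :=
    hf.meromorphicOn.circleIntegrable_log_norm
  have hi2 : ∀ a : ℂ, CircleIntegrable (fun z => log ‖z - a‖) 0 R := fun a =>
    circleIntegrable_log_norm_sub_const R
  have hi4 : ∀ a ∈ s, CircleIntegrable (fun z => |d a| * |log ‖z - a‖|) 0 R := fun a _ =>
    (hi2 a).abs.const_smul
  have hi5 : CircleIntegrable (fun z => ∑ a ∈ s, |d a| * |log ‖z - a‖|) 0 R :=
    CircleIntegrable.fun_sum s hi4
  have hi6 : CircleIntegrable (fun z => log ‖f z‖ - ∑ a ∈ s, d a * log ‖z - a‖) 0 R :=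
    hi1.sub (CircleIntegrable.fun_sum s fun a _ => (hi2 a).const_smul)
  calc circleAverage (fun z => |log ‖g z‖|) 0 R
      = circleAverage (fun z => |log ‖f z‖ - ∑ a ∈ s, d a * log ‖z - a‖|) 0 R := by
        apply circleAverage_congr_codiscreteWithin _ hR0.ne'
        rw [abs_of_pos hR0]
        filter_upwards [codiscreteWithin_mono sphere_subset_closedBall hfg] with z hz
        rw [hz, add_sub_cancel_left]
    _ ≤ circleAverage (fun z => |log ‖f z‖| + ∑ a ∈ s, |d a| * |log ‖z - a‖|) 0 R := by
        refine circleAverage_mono hi6.abs (hi1.abs.add hi5) fun z _ => ?_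
        refine (abs_sub _ _).trans ?_
        gcongr
        refine (Finset.abs_sum_le_sum_abs _ _).trans_eq ?_
        simp_rw [abs_mul]
    _ = circleAverage (fun z => |log ‖f z‖|) 0 R +
          ∑ a ∈ s, |d a| * circleAverage (fun z => |log ‖z - a‖|) 0 R := by
        have hi7 : CircleIntegrable (fun z => |log ‖f z‖|) 0 R := hi1.abs
        rw [circleAverage_fun_add hi7 hi5, circleAverage_fun_sum hi4]
        congr 1
        refine Finset.sum_congr rfl fun a _ => ?_
        simp_rw [← smul_eq_mul (|d a|)]
        exact circleAverage_fun_smul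
    _ ≤ _ := by
        rw [circleAverage_abs_log_norm_eq hf, Finset.sum_mul]
        gcongr with a ha
        exact circleAverage_abs_log_norm_sub_le hR (hs a ha)

/-! ### The q-difference quotient -/

open Real Metric ValueDistribution in
/-- The proximity function of a `q`-difference quotient, estimated by data on a larger disk. -/
lemma exists_proximity_comp_mul_div_le {f : ℂ → ℂ} (hf : Meromorphic f)
    (hf0 : ∀ z, meromorphicOrderAt f z ≠ ⊤) {q : ℂ} (hq : q ≠ 0) {r R ρ : ℝ} (hr : 1 ≤ r)
    (hrρ : r ≤ ρ) (hqρ : ‖q‖ * r ≤ ρ) (hρR : 2 * ρ ≤ R) :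
    ∃ n : ℝ, 0 ≤ n ∧ n * log R ≤ logCounting f ⊤ (R ^ 2) + logCounting f⁻¹ ⊤ (R ^ 2) ∧
      proximity (fun z => f (q * z) / f z) ⊤ r ≤ n * (2 * log 2 + 2 * |log ‖q‖|) +
        6 * ρ / R * (proximity f ⊤ R + proximity f⁻¹ ⊤ R + n * log (4 * R)) := by
  have hr0 : 0 < r := by linarith
  have hR : 1 ≤ R := by linarith
  have hR0 : 0 < R := by linarith
  obtain ⟨s, g, hs, hg, hg0, hfg⟩ := exists_log_norm_eq_sum_add hf hf0 R
  set D := MeromorphicOn.divisor f Set.univ with hD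
  set d : ℂ → ℝ := fun a => (D a : ℝ) with hd
  refine ⟨∑ a ∈ s, |d a|, Finset.sum_nonneg fun a _ => abs_nonneg _, ?_, ?_⟩
  · have h1 := sum_mul_log_le_logCounting (negPart_nonneg D) hR s hs
    have h2 := sum_mul_log_le_logCounting (posPart_nonneg D) hR s hs
    rw [logCounting_inv, logCounting_top, logCounting_zero, ← hD]
    refine le_trans (le_of_eq ?_) (add_le_add h1 h2)
    rw [← add_mul, ← Finset.sum_add_distrib]
    congr 1
    refine Finset.sum_congr rfl fun a _ => ?_
    rw [hd, Function.locallyFinsuppWithin.negPart_apply,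
      Function.locallyFinsuppWithin.posPart_apply]
    have := posPart_add_negPart (D a)
    rw [add_comm, ← Int.cast_add, this, Int.cast_abs]
  · have hA := circleAverage_abs_log_norm_analytic_le hf hR s d hs hfg
    set A := circleAverage (fun z => |log ‖g z‖|) 0 R
    have hiq : CircleIntegrable (fun z => log ‖f (q * z)‖) 0 r :=
      (hf.comp_const_mul q).meromorphicOn.circleIntegrable_log_norm
    have hi1 : CircleIntegrable (fun z => log ‖f z‖) 0 r :=
      hf.meromorphicOn.circleIntegrable_log_norm
    have hi2 : ∀ a : ℂ, CircleIntegrable (fun z => |log ‖q * z - a‖ - log ‖z - a‖|) 0 r := fun a =>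
      CircleIntegrable.abs (CircleIntegrable.sub
        (MeromorphicOn.circleIntegrable_log_norm (f := fun z => q * z - a) fun z _ => by fun_prop)
        (circleIntegrable_log_norm_sub_const r))
    have hi4 : ∀ a ∈ s, CircleIntegrable (fun z => |d a| * |log ‖q * z - a‖ - log ‖z - a‖|) 0 r :=
      fun a _ => (hi2 a).const_smul
    have hi5 : CircleIntegrable
        (fun z => ∑ a ∈ s, |d a| * |log ‖q * z - a‖ - log ‖z - a‖|) 0 r :=
      CircleIntegrable.fun_sum s hi4
    set F : ℂ → ℝ := fun z => ∑ a ∈ s, |d a| * |log ‖q * z - a‖ - log ‖z - a‖| + 6 * ρ / R * A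
    have hF : CircleIntegrable F 0 r := hi5.add (circleIntegrable_const _ _ _)
    -- The bound by `F` holds only off a discrete set, whereas `circleAverage_mono` needs it on the
    -- whole circle; the minimum with `F` has the same average and is bounded everywhere.
    have hmin : ∀ᶠ z in codiscreteWithin (sphere (0 : ℂ) r),
        |log ‖f (q * z)‖ - log ‖f z‖| = min |log ‖f (q * z)‖ - log ‖f z‖| (F z) := by
      have h1 := eventually_codiscreteWithin_sphere_mul hq (hqρ.trans (by linarith)) hfg
      have h2 := eventually_codiscreteWithin_sphere_mul (r := r) one_ne_zero (by simp; linarith) hfg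
      filter_upwards [h1, h2, self_mem_codiscreteWithin _] with z hz1 hz2 hz
      rw [mem_sphere_zero_iff_norm] at hz
      rw [one_mul] at hz2
      symm
      apply min_eq_left
      have hgg := abs_log_norm_sub_log_norm_le hg hg0 hR0 hρR
        (by rw [norm_mul, hz]; exact hqρ) (hz.trans_le hrρ) (w := q * z) (w' := z)
      rw [hz1, hz2, add_sub_add_comm, ← Finset.sum_sub_distrib]
      refine (abs_add_le _ _).trans (add_le_add ?_ hgg)
      refine (Finset.abs_sum_le_sum_abs _ _).trans_eq ?_
      simp_rw [← mul_sub, abs_mul]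
      rfl
    rw [proximity_top]
    calc circleAverage (fun z => log⁺ ‖f (q * z) / f z‖) 0 r
        ≤ circleAverage (fun z => |log ‖f (q * z)‖ - log ‖f z‖|) 0 r := by
          refine circleAverage_mono
            ((hf.comp_const_mul q).div hf).meromorphicOn.circleIntegrable_posLog_norm
            (hiq.sub hi1).abs fun z _ => ?_
          rw [norm_div]
          rcases eq_or_ne ‖f (q * z)‖ 0 with h1 | h1
          · simp [h1]
          rcases eq_or_ne ‖f z‖ 0 with h2 | h2
          · simp [h2]
          rw [posLog_apply, log_div h1 h2]
          exact max_le (abs_nonneg _) (le_abs_self _)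
      _ = circleAverage (fun z => min |log ‖f (q * z)‖ - log ‖f z‖| (F z)) 0 r := by
          apply circleAverage_congr_codiscreteWithin _ hr0.ne'
          rwa [abs_of_pos hr0]
      _ ≤ circleAverage F 0 r := by
          refine circleAverage_mono ?_ hF fun z _ => min_le_right _ _
          refine CircleIntegrable.congr_codiscreteWithin ?_ (hiq.sub hi1).abs
          rwa [abs_of_pos hr0]
      _ = ∑ a ∈ s, |d a| * circleAverage (fun z => |log ‖q * z - a‖ - log ‖z - a‖|) 0 r +
            6 * ρ / R * A := by
          rw [circleAverage_fun_add hi5 (circleIntegrable_const _ _ _), circleAverage_const,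
            circleAverage_fun_sum hi4]
          congr 1
          refine Finset.sum_congr rfl fun a _ => ?_
          simp_rw [← smul_eq_mul (|d a|)]
          exact circleAverage_fun_smul
      _ ≤ _ := by
          have hρ0 : 0 < ρ := by linarith
          rw [Finset.sum_mul]
          gcongr with a ha
          exact circleAverage_abs_log_norm_mul_sub_sub_le hq hr a

/-! ### Logarithmic order and growth -/

open Real ValueDistribution in
lemma eventually_characteristic_le_log_rpow {f : ℂ → ℂ} {σ s : ℝ} (hσ : logOrder f = (σ : EReal))
    (hs : σ < s) : ∀ᶠ r in atTop, characteristic f ⊤ r ≤ log r ^ s := by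
  have hlim : ∀ᶠ r : ℝ in atTop,
      ((log⁺ (characteristic f ⊤ r) / log (log r) : ℝ) : EReal) < (s : EReal) := by
    refine eventually_lt_of_limsup_lt ?_
    rw [← logOrder, hσ]
    exact_mod_cast hs
  have h1 := (tendsto_log_atTop.comp tendsto_log_atTop).eventually_gt_atTop 0
  have h2 := tendsto_log_atTop.eventually_gt_atTop 0
  filter_upwards [hlim, h1, h2, characteristic_eventually_nonneg (f := f) (a := ⊤)]
    with r hr h1 h2 h3
  simp only [Function.comp_apply] at h1
  rw [EReal.coe_lt_coe_iff, div_lt_iff₀ h1] at hr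
  rcases h3.eq_or_lt with h | h
  · rw [← h]
    exact (rpow_pos_of_pos h2 s).le
  · rw [← log_le_log_iff h (rpow_pos_of_pos h2 s), log_rpow h2]
    exact (le_max_right _ _).trans hr.le

-- Nonnegativity gives (log r)^s ≥ 1 for large r, which absorbs the bounded error of the first main
-- theorem.
open Real ValueDistribution in
lemma nonneg_of_logOrder_eq {f : ℂ → ℂ} {σ : ℝ} (hσ : logOrder f = (σ : EReal)) : 0 ≤ σ := by
  have : (0 : EReal) ≤ logOrder f := by
    refine le_limsup_of_frequently_le (Eventually.frequently ?_)
    filter_upwards [(tendsto_log_atTop.comp tendsto_log_atTop).eventually_gt_atTop 0] with r hr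
    exact EReal.coe_nonneg.2 (div_nonneg posLog_nonneg (le_of_lt hr))
  rw [hσ] at this
  exact_mod_cast this

open Real ValueDistribution in
/-- The logarithmic `q`-difference lemma: if the characteristic function of `f` is at most
`(log r) ^ s`, then the proximity function of `f (q z) / f z` is `O((log r) ^ (s - 1))`. -/
lemma isBigO_proximity_comp_mul_div {f : ℂ → ℂ} (hf : Meromorphic f)
    (hf0 : ∀ z, meromorphicOrderAt f z ≠ ⊤) {s : ℝ} (hs : 0 ≤ s)
    (hT : ∀ᶠ r in atTop, characteristic f ⊤ r ≤ log r ^ s) {q : ℂ} (hq : q ≠ 0) :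
    proximity (fun z => f (q * z) / f z) ⊤ =O[atTop] fun r : ℝ => log r ^ (s - 1) := by
  set M := max 1 ‖q‖ with hM
  have hM1 : 1 ≤ M := le_max_left _ _
  obtain ⟨c, hc0, hc⟩ : ∃ c, 0 ≤ c ∧ ∀ r,
      characteristic f⁻¹ ⊤ r ≤ characteristic f ⊤ r + c :=
    ⟨_, (abs_nonneg _).trans (le_max_left _ _), fun r => by
      have := (abs_le.1 (characteristic_sub_characteristic_inv_le hf (R := r))).1
      linarith⟩
  -- Chosen so that T(r⁴, f) + T(r⁴, 1/f) ≤ K (log r)^s; the same bound then serves at r².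
  set K : ℝ := 2 * 4 ^ s + c with hK
  have hK0 : 0 ≤ K := by positivity
  set C := 2 * log 2 + 2 * |log ‖q‖| with hC
  have hC0 : 0 ≤ C := by
    have := log_nonneg (show (1 : ℝ) ≤ 2 by norm_num)
    positivity
  -- Here 30 = 6 · (1 + 4): the Harnack constant 6, and log(4r²) ≤ 4 log r.
  refine IsBigO.of_bound (K * C + 30 * M * K) ?_
  filter_upwards [(tendsto_pow_atTop (α := ℝ) two_ne_zero).eventually hT,
    (tendsto_pow_atTop (α := ℝ) four_ne_zero).eventually hT, eventually_ge_atTop (2 * M),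
    tendsto_log_atTop.eventually_ge_atTop 1] with r h2 h4 hrM hL
  have hr1 : 1 ≤ r := by linarith
  have hr0 : 0 < r := by linarith
  set L := log r with hLdef
  have hL0 : 0 < L := by linarith
  set P := L ^ (s - 1) with hP
  have hP0 : 0 < P := rpow_pos_of_pos hL0 _
  have hPL : L ^ s = P * L := by
    rw [hP, ← rpow_add_one hL0.ne', sub_add_cancel]
  have hPL1 : 1 ≤ P * L := hPL ▸ one_le_rpow hL hs
  have h24 : (2 : ℝ) ^ s ≤ 4 ^ s := rpow_le_rpow (by norm_num) (by norm_num) hs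
  rw [log_pow, mul_rpow (by norm_num) hL0.le, hPL] at h2 h4
  push_cast at h2 h4
  have hcP : c ≤ c * (P * L) := le_mul_of_one_le_right hc0 hPL1
  have h24P : 2 ^ s * (P * L) ≤ 4 ^ s * (P * L) := by gcongr
  have hKPL : K * (P * L) = 2 * (4 ^ s * (P * L)) + c * (P * L) := by rw [hK]; ring
  obtain ⟨n, hn0, hn, hprox⟩ := exists_proximity_comp_mul_div_le hf hf0 hq hr1 (R := r ^ 2)
    (ρ := M * r) (le_mul_of_one_le_left hr0.le hM1)
    (mul_le_mul_of_nonneg_right (le_max_right _ _) hr0.le) (by nlinarith)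
  have hnP : n ≤ K * P := by
    rw [← pow_mul, log_pow] at hn
    norm_num at hn
    have hr4 : 1 ≤ r ^ 4 := one_le_pow₀ hr1
    have e1 : logCounting f ⊤ (r ^ 4) ≤ characteristic f ⊤ (r ^ 4) :=
      le_add_of_nonneg_left (proximity_nonneg _)
    have e2 : logCounting f⁻¹ ⊤ (r ^ 4) ≤ characteristic f⁻¹ ⊤ (r ^ 4) :=
      le_add_of_nonneg_left (proximity_nonneg _)
    rw [logCounting_inv] at e2
    have e3 := hc (r ^ 4)
    have e4 : n * (2 * L) ≤ K * P * L := by linarith [mul_assoc K P L]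
    have e5 : 0 ≤ n * L := by positivity
    exact le_of_mul_le_mul_right (by linarith) hL0
  have hm : proximity f ⊤ (r ^ 2) + proximity f⁻¹ ⊤ (r ^ 2) ≤ K * (P * L) := by
    have hr2 : 1 ≤ r ^ 2 := one_le_pow₀ hr1
    have e1 : proximity f ⊤ (r ^ 2) ≤ characteristic f ⊤ (r ^ 2) :=
      le_add_of_nonneg_right (logCounting_nonneg hr2)
    have e2 : proximity f⁻¹ ⊤ (r ^ 2) ≤ characteristic f⁻¹ ⊤ (r ^ 2) :=
      le_add_of_nonneg_right (logCounting_nonneg hr2)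
    linarith [hc (r ^ 2)]
  have hlog : log (4 * r ^ 2) ≤ 4 * L := by
    rw [show 4 * r ^ 2 = (2 * r) ^ 2 by ring, log_pow, log_mul two_ne_zero hr0.ne']
    push_cast
    linarith [log_two_lt_d9]
  have hlog0 : 0 ≤ log (4 * r ^ 2) := log_nonneg (by nlinarith)
  have hρR : 6 * (M * r) / r ^ 2 = 6 * M / r := by field_simp
  rw [norm_of_nonneg (proximity_nonneg _), norm_of_nonneg hP0.le]
  calc _ ≤ _ := hprox
    _ ≤ K * P * C + 6 * M / r * (K * (P * L) + K * P * (4 * L)) := by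
      rw [hρR]
      gcongr
    _ = K * P * C + 30 * M * K * P * (L / r) := by ring
    _ ≤ K * P * C + 30 * M * K * P * 1 := by
      gcongr
      rw [div_le_one hr0]
      exact (log_le_sub_one_of_pos hr0).trans (by linarith)
    _ = _ := by ring

/-- A meromorphic function of infinite order at some point vanishes off a discrete set. -/
lemma Meromorphic.eventuallyEq_zero_of_meromorphicOrderAt_eq_top {f : ℂ → ℂ} (hf : Meromorphic f)
    {z : ℂ} (hz : meromorphicOrderAt f z = ⊤) : f =ᶠ[codiscrete ℂ] fun _ => 0 := by
  have htop : ∀ u, meromorphicOrderAt f u = ⊤ := by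
    by_contra! h
    exact hf.exists_meromorphicOrderAt_ne_top_iff_forall.1 h z hz
  filter_upwards [hf.meromorphicOn.meromorphicNFAt_mem_codiscreteWithin] with u hu
  by_contra h
  have := hu.meromorphicOrderAt_eq_zero_iff.2 h
  rw [htop u] at this
  exact absurd this (by simp)

/-! ### Iterated Jackson operators -/

lemma Meromorphic.jacksonDIter {f : ℂ → ℂ} (hf : Meromorphic f) (q : ℂ) (k : ℕ) :
    Meromorphic (jacksonDIter q k f) := by
  induction k with
  | zero => exact hf
  | succ k ih =>
    have h1 : Meromorphic fun z : ℂ => q * z - z := fun z => by fun_prop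
    exact ((ih.comp_const_mul q).sub ih).div h1

/-- Pointwise bound for the iterated Jackson operator. -/
lemma exists_norm_jacksonDIter_le {q : ℂ} (hq : q ≠ 0) (hq1 : q ≠ 1) (f : ℂ → ℂ) (k : ℕ) :
    ∃ C : ℝ, 0 ≤ C ∧ ∀ z : ℂ, z ≠ 0 → ‖jacksonDIter q k f z‖ ≤
      C / ‖z‖ ^ k * ∑ j ∈ Finset.range (k + 1), ‖f (q ^ j * z)‖ := by
  induction k with
  | zero => exact ⟨1, zero_le_one, fun z _ => by simp [jacksonDIter]⟩
  | succ k ih =>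
    obtain ⟨C, hC, h⟩ := ih
    have hq0 : 0 < ‖q‖ := norm_pos_iff.2 hq
    have hq10 : 0 < ‖q - 1‖ := norm_pos_iff.2 (sub_ne_zero.2 hq1)
    refine ⟨C * ((‖q‖ ^ k)⁻¹ + 1) / ‖q - 1‖, by positivity, fun z hz => ?_⟩
    have hz0 : 0 < ‖z‖ := norm_pos_iff.2 hz
    set S := ∑ j ∈ Finset.range (k + 1 + 1), ‖f (q ^ j * z)‖ with hS
    have h1 : ‖jacksonDIter q k f (q * z)‖ ≤ C / ‖q * z‖ ^ k * S := by
      refine (h _ (mul_ne_zero hq hz)).trans ?_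
      gcongr
      rw [hS, Finset.sum_range_succ' _ (k + 1)]
      refine le_trans (le_of_eq ?_) (le_add_of_nonneg_right (norm_nonneg _))
      refine Finset.sum_congr rfl fun j _ => ?_
      rw [pow_succ, mul_assoc]
    have h2 : ‖jacksonDIter q k f z‖ ≤ C / ‖z‖ ^ k * S := by
      refine (h _ hz).trans ?_
      gcongr
      rw [hS, Finset.sum_range_succ _ (k + 1)]
      exact le_add_of_nonneg_right (norm_nonneg _)
    calc ‖jacksonDIter q (k + 1) f z‖
        = ‖jacksonDIter q k f (q * z) - jacksonDIter q k f z‖ / (‖q - 1‖ * ‖z‖) := by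
          rw [jacksonDIter, jacksonD, norm_div, ← norm_mul, sub_mul, one_mul]
      _ ≤ (C / ‖q * z‖ ^ k * S + C / ‖z‖ ^ k * S) / (‖q - 1‖ * ‖z‖) := by
          gcongr
          exact (norm_sub_le _ _).trans (add_le_add h1 h2)
      _ = _ := by
          rw [norm_mul, mul_pow]
          field_simp
          ring

-- For k ≥ 1 the factor r^(-k) absorbs all constants, so the Jackson quotient is at most the mean of
-- the k + 1 dilation quotients, hence at most one of them. This avoids any additive constant from
-- log⁺ of a sum.
open Real ValueDistribution in
lemma eventually_proximity_jacksonDIter_div_le {f : ℂ → ℂ} (hf : Meromorphic f) {q : ℂ}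
    (hq : q ≠ 0) (hq1 : q ≠ 1) {k : ℕ} (hk : k ≠ 0) :
    ∀ᶠ r in atTop, proximity (fun z => jacksonDIter q k f z / f z) ⊤ r ≤
      ∑ j ∈ Finset.range (k + 1), proximity (fun z => f (q ^ j * z) / f z) ⊤ r := by
  obtain ⟨C, hC, hbound⟩ := exists_norm_jacksonDIter_le hq hq1 f k
  have hi : ∀ j ∈ Finset.range (k + 1), ∀ r : ℝ,
      CircleIntegrable (fun z => log⁺ ‖f (q ^ j * z) / f z‖) 0 r := fun j _ r =>
    ((hf.comp_const_mul (q ^ j)).div hf).meromorphicOn.circleIntegrable_posLog_norm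
  filter_upwards [eventually_ge_atTop 1, eventually_ge_atTop (C * (k + 1))] with r hr1 hrC
  have hr0 : 0 < r := by linarith
  simp only [proximity_top]
  rw [← circleAverage_fun_sum fun j hj => hi j hj r]
  refine circleAverage_mono
    ((hf.jacksonDIter q k).div hf).meromorphicOn.circleIntegrable_posLog_norm
    (CircleIntegrable.fun_sum _ fun j hj => hi j hj r) fun z hz => ?_
  rw [abs_of_pos hr0, mem_sphere_zero_iff_norm] at hz
  have hz0 : z ≠ 0 := norm_pos_iff.1 (hz ▸ hr0)
  have hle : ‖jacksonDIter q k f z / f z‖ * (k + 1) ≤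
      ∑ j ∈ Finset.range (k + 1), ‖f (q ^ j * z) / f z‖ := by
    simp_rw [norm_div, ← Finset.sum_div]
    rw [div_mul_eq_mul_div]
    gcongr
    calc ‖jacksonDIter q k f z‖ * (k + 1)
        ≤ C / ‖z‖ ^ k * (∑ j ∈ Finset.range (k + 1), ‖f (q ^ j * z)‖) * (k + 1) := by
          gcongr; exact hbound z hz0
      _ = C * (k + 1) / r ^ k * ∑ j ∈ Finset.range (k + 1), ‖f (q ^ j * z)‖ := by rw [hz]; ring
      _ ≤ 1 * ∑ j ∈ Finset.range (k + 1), ‖f (q ^ j * z)‖ := by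
          gcongr
          rw [div_le_one (by positivity)]
          exact hrC.trans (le_self_pow₀ hr1 hk)
      _ = _ := one_mul _
  obtain ⟨j, hj, hjle⟩ : ∃ j ∈ Finset.range (k + 1),
      ‖jacksonDIter q k f z / f z‖ ≤ ‖f (q ^ j * z) / f z‖ := by
    refine Finset.exists_le_of_sum_le Finset.nonempty_range_add_one ?_
    rw [Finset.sum_const, Finset.card_range, nsmul_eq_mul]
    push_cast
    rwa [mul_comm]
  exact (posLog_le_posLog (norm_nonneg _) hjle).trans
    (Finset.single_le_sum (f := fun j => log⁺ ‖f (q ^ j * z) / f z‖)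
      (fun _ _ => posLog_nonneg) hj)

open Real ValueDistribution in
lemma proximity_div_self (f : ℂ → ℂ) : proximity (fun z => f z / f z) ⊤ = 0 := by
  have : (fun z => log⁺ ‖f z / f z‖) = fun _ => 0 := by
    ext z
    rcases eq_or_ne (f z) 0 with h | h <;> simp [h]
  ext r
  rw [proximity_top, this, Real.circleAverage_const, Pi.zero_apply]

/-! ### The main theorem -/

theorem lemma4p5 (f : ℂ → ℂ) (hf : Meromorphic f)
    (hnc : ¬ ∃ c : ℂ, f =ᶠ[codiscrete ℂ] fun _ => c)
    (σ : ℝ) (hσ : logOrder f = (σ : EReal))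
    (k : ℕ) (q : ℂ) (hq : q ≠ 0) (ε : ℝ) (hε : 0 < ε) :
    (ValueDistribution.proximity (fun z => f (q ^ k * z) / f z) ⊤
        =O[atTop] fun r : ℝ => Real.log r ^ (σ - 1 + ε)) ∧
    (q ≠ 1 →
      ValueDistribution.proximity (fun z => jacksonDIter q k f z / f z) ⊤
        =O[atTop] fun r : ℝ => Real.log r ^ (σ - 1 + ε)) := by
  -- Nonconstancy enters with the constant 0: finite order everywhere is what the factorization
  -- needs.
  have hf0 : ∀ z, meromorphicOrderAt f z ≠ ⊤ := fun z hz =>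
    hnc ⟨0, hf.eventuallyEq_zero_of_meromorphicOrderAt_eq_top hz⟩
  have hσ0 := nonneg_of_logOrder_eq hσ
  have hT := eventually_characteristic_le_log_rpow hσ (lt_add_of_pos_right σ hε)
  have hmain : ∀ j : ℕ, ValueDistribution.proximity (fun z => f (q ^ j * z) / f z) ⊤
      =O[atTop] fun r : ℝ => Real.log r ^ (σ - 1 + ε) := fun j => by
    rw [sub_add_eq_add_sub]
    exact isBigO_proximity_comp_mul_div hf hf0 (by linarith) hT (pow_ne_zero j hq)
  refine ⟨hmain k, fun hq1 => ?_⟩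
  -- For k = 0 there is no decay r^(-k), but f/f takes only the values 0 and 1.
  rcases eq_or_ne k 0 with rfl | hk
  · simp only [jacksonDIter, proximity_div_self]
    exact isBigO_zero _ _
  · refine IsBigO.trans ?_ (IsBigO.fun_sum fun j (_ : j ∈ Finset.range (k + 1)) => hmain j)
    refine IsBigO.of_bound 1 ?_
    filter_upwards [eventually_proximity_jacksonDIter_div_le hf hq hq1 hk] with r hr
    rw [one_mul, Real.norm_of_nonneg (ValueDistribution.proximity_nonneg _)]
    exact hr.trans (le_abs_self _)
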